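/- Let $M$ be a smooth manifold of dimension $2n+s$ with a C-structure $(\varphi,\xi_\alpha,\eta^\alpha,g)$, $\alpha=1,\dots,s$. That is, $g$ is a Riemannian metric, $\varphi$ a $(1,1)$-tensor field, $\xi_\alpha$ are vector fields and $\eta^\alpha$ are $1$-forms (all smooth) such that $$\varphi^2X=-X+\sum_{\alpha}\eta^\alpha(X)\,\xi_\alpha,\quad \eta^\alpha(\xi_\beta)=\delta^\alpha_\beta,\quad \varphi\xi_\alpha=0,\quad \eta^\alpha(\varphi X)=0,\quad \eta^\alpha(X)=g(X,\xi_\alpha),$$ $$g(\varphi X,\varphi Y)=g(X,Y)-\sum_\alpha\eta^\alpha(X)\eta^\alpha(Y);$$ the structure is normal, i.e. the Nijenhuis tensor of $\varphi$ is $N_\varphi(X,Y)=-2\sum_\alpha d\eta^\alpha(X,Y)\,\xi_\alpha$; and, with $\Omega(X,Y)=g(X,\varphi Y)$, one has $d\Omega=0$ and $d\eta^\alpha=0$ for all $\alpha$. Let $I\subseteq\mathbb R$ be a nondegenerate interval and $\gamma:I\to M$ a smooth unit-speed curve with velocity $T=\gamma'$ which is a Legendre curve, i.e. $g(T,\xi_\alpha)=0$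 along $\gamma$ for all $\alpha$. Suppose that $\gamma$ is a Frenet curve of osculating order $r$, $1\le r\le\dim M$: there are smooth $g$-orthonormal vector fields $v_1=T,v_2,\dots,v_r$ along $\gamma$ and positive functions $\kappa_1,\dots,\kappa_{r-1}$ on $I$ such that, for the Levi-Civita connection $\nabla$ of $g$, $$\nabla_Tv_i=-\kappa_{i-1}v_{i-1}+\kappa_iv_{i+1}\qquad(1\le i\le r),$$ where the term with $\kappa_0$ (for $i=1$) and the term with $\kappa_r$ (for $i=r$) are absent. Then, for every $\alpha=1,\dots,s$ and every $t\in I$, the vector $\xi_\alpha$ at $\gamma(t)$ is $g$-orthogonal to $\mathrm{span}\{T(t),v_2(t),\dots,v_r(t)\}$. -/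

import Mathlib

open Manifold ContDiff Bundle VectorField

noncomputable section

namespace FramedGeometry

variable {E : Type*} [NormedAddCommGroup E] [NormedSpace ℝ E]
  {M : Type*} [TopologicalSpace M] [ChartedSpace E M]

/-! ### Vector fields, differential forms, brackets -/

/-- The vector field `X`, defined around `x`, is smooth near `x`. -/
def SmoothFieldAt [IsManifold 𝓘(ℝ, E) ∞ M] (X : Π y : M, TangentSpace 𝓘(ℝ, E) y) (x : M) : Prop :=
  ContMDiffAt 𝓘(ℝ, E) (𝓘(ℝ, E).prod 𝓘(ℝ, E)) ∞
    (fun y : M => TotalSpace.mk' E (E := (TangentSpace 𝓘(ℝ, E) : M → Type _)) y (X y)) x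

/-- `X f` at the point `x`: the derivative of the function `f` in the direction `X x`. -/
def dirDeriv (X : Π y : M, TangentSpace 𝓘(ℝ, E) y) (f : M → ℝ) (x : M) : ℝ :=
  mfderiv 𝓘(ℝ, E) 𝓘(ℝ, ℝ) f x (X x)

/-- Exterior derivative of a 1-form evaluated on two vector fields:
`dθ(X, Y) = 1/2 (X (θ Y) - Y (θ X) - θ [X, Y])`. -/
def extDerivOne (θ : Π y : M, TangentSpace 𝓘(ℝ, E) y →L[ℝ] ℝ)
    (X Y : Π y : M, TangentSpace 𝓘(ℝ, E) y) (x : M) : ℝ :=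
  (1 / 2 : ℝ) *
    (dirDeriv X (fun y => θ y (Y y)) x - dirDeriv Y (fun y => θ y (X y)) x
      - θ x (mlieBracket 𝓘(ℝ, E) X Y x))

/-- Exterior derivative of a 2-form evaluated on three vector fields, i.e. `1/3` times
`X θ(Y, Z) + Y θ(Z, X) + Z θ(X, Y) - θ([X, Y], Z) - θ([Y, Z], X) - θ([Z, X], Y)`. -/
def extDerivTwo (θ : Π y : M, TangentSpace 𝓘(ℝ, E) y → TangentSpace 𝓘(ℝ, E) y → ℝ)
    (X Y Z : Π y : M, TangentSpace 𝓘(ℝ, E) y) (x : M) : ℝ :=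
  (1 / 3 : ℝ) *
    (dirDeriv X (fun y => θ y (Y y) (Z y)) x + dirDeriv Y (fun y => θ y (Z y) (X y)) x
      + dirDeriv Z (fun y => θ y (X y) (Y y)) x
      - θ x (mlieBracket 𝓘(ℝ, E) X Y x) (Z x) - θ x (mlieBracket 𝓘(ℝ, E) Y Z x) (X x)
      - θ x (mlieBracket 𝓘(ℝ, E) Z X x) (Y x))

/-- Nijenhuis tensor of a `(1,1)`-tensor field `φ`, evaluated on two vector fields:
`N(X, Y) = φ² [X, Y] + [φ X, φ Y] - φ [φ X, Y] - φ [X, φ Y]`. -/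
def nijenhuis (φ : Π y : M, TangentSpace 𝓘(ℝ, E) y →L[ℝ] TangentSpace 𝓘(ℝ, E) y)
    (X Y : Π y : M, TangentSpace 𝓘(ℝ, E) y) (x : M) : TangentSpace 𝓘(ℝ, E) x :=
  φ x (φ x (mlieBracket 𝓘(ℝ, E) X Y x))
    + mlieBracket 𝓘(ℝ, E) (fun y => φ y (X y)) (fun y => φ y (Y y)) x
    - φ x (mlieBracket 𝓘(ℝ, E) (fun y => φ y (X y)) Y x)
    - φ x (mlieBracket 𝓘(ℝ, E) X (fun y => φ y (Y y)) x)

/-! ### Framed metric manifolds and C-manifolds -/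

variable [IsManifold 𝓘(ℝ, E) ∞ M]

variable (E M) in
/-- A smooth Riemannian metric on `M`. -/
abbrev Metric : Type _ :=
  ContMDiffRiemannianMetric (𝓘(ℝ, E)) ∞ E (fun x : M => TangentSpace 𝓘(ℝ, E) x)

variable (E M) in
/-- A framed `φ`-structure `(φ, ξ_α, η^α, g)`, `α = 1, …, s`, on `M`. -/
structure FramedStructure (s : ℕ) where
  /-- the Riemannian metric -/
  g : Metric E M
  /-- the `(1,1)`-tensor field -/
  φ : Π x : M, TangentSpace 𝓘(ℝ, E) x →L[ℝ] TangentSpace 𝓘(ℝ, E) x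
  /-- the vector fields -/
  ξ : Fin s → Π x : M, TangentSpace 𝓘(ℝ, E) x
  /-- the 1-forms -/
  η : Fin s → Π x : M, TangentSpace 𝓘(ℝ, E) x →L[ℝ] ℝ
  smooth_φ : ContMDiff 𝓘(ℝ, E) (𝓘(ℝ, E).prod 𝓘(ℝ, E →L[ℝ] E)) ∞
    (fun x : M => TotalSpace.mk' (E →L[ℝ] E)
      (E := fun x : M => TangentSpace 𝓘(ℝ, E) x →L[ℝ] TangentSpace 𝓘(ℝ, E) x) x (φ x))
  smooth_ξ : ∀ α x, SmoothFieldAt (ξ α) x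
  smooth_η : ∀ α, ContMDiff 𝓘(ℝ, E) (𝓘(ℝ, E).prod 𝓘(ℝ, E →L[ℝ] ℝ)) ∞
    (fun x : M => TotalSpace.mk' (E →L[ℝ] ℝ)
      (E := fun x : M => TangentSpace 𝓘(ℝ, E) x →L[ℝ] Trivial M ℝ x) x (η α x))
  φ_sq : ∀ x (X : TangentSpace 𝓘(ℝ, E) x), φ x (φ x X) = -X + ∑ α, η α x X • ξ α x
  η_ξ : ∀ x α β, η α x (ξ β x) = if α = β then 1 else 0
  φ_ξ : ∀ x α, φ x (ξ α x) = 0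
  η_φ : ∀ x α (X : TangentSpace 𝓘(ℝ, E) x), η α x (φ x X) = 0
  η_eq : ∀ x α (X : TangentSpace 𝓘(ℝ, E) x), η α x X = g.inner x X (ξ α x)
  g_φ : ∀ x (X Y : TangentSpace 𝓘(ℝ, E) x),
    g.inner x (φ x X) (φ x Y) = g.inner x X Y - ∑ α, η α x X * η α x Y

namespace FramedStructure

variable {s : ℕ} (F : FramedStructure E M s)

/-- The fundamental 2-form `Ω(X, Y) = g(X, φ Y)`. -/
def Ω (x : M) (X Y : TangentSpace 𝓘(ℝ, E) x) : ℝ := F.g.inner x X (F.φ x Y)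

/-- A C-structure: a framed `φ`-structure which is normal, i.e.
`N_φ(X, Y) = -2 ∑_α dη^α(X, Y) ξ_α`, and such that `dΩ = 0` and `dη^α = 0` for all `α`. The
tensorial identities are tested on all vector fields that are smooth near the given point. -/
structure IsCStructure : Prop where
  normal : ∀ (x : M) (X Y : Π y : M, TangentSpace 𝓘(ℝ, E) y),
    SmoothFieldAt X x → SmoothFieldAt Y x →
      nijenhuis F.φ X Y x = -(2 : ℝ) • ∑ α, extDerivOne (F.η α) X Y x • F.ξ α x
  closed_Ω : ∀ (x : M) (X Y Z : Π y : M, TangentSpace 𝓘(ℝ, E) y),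
    SmoothFieldAt X x → SmoothFieldAt Y x → SmoothFieldAt Z x → extDerivTwo F.Ω X Y Z x = 0
  closed_η : ∀ (α : Fin s) (x : M) (X Y : Π y : M, TangentSpace 𝓘(ℝ, E) y),
    SmoothFieldAt X x → SmoothFieldAt Y x → extDerivOne (F.η α) X Y x = 0

end FramedStructure

/-! ### The Levi-Civita connection along a curve, in charts -/

/-- The metric in the preferred chart `ψ` at `p`:
`metricInChart g p y u v = g (dψ⁻¹ u, dψ⁻¹ v)` at the point `ψ⁻¹ y`. -/
def metricInChart (g : Metric E M) (p : M) (y : E) : E →L[ℝ] E →L[ℝ] ℝ :=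
  let x : M := (extChartAt 𝓘(ℝ, E) p).symm y
  let A : E →L[ℝ] E := mfderiv 𝓘(ℝ, E) 𝓘(ℝ, E) (extChartAt 𝓘(ℝ, E) p).symm y
  let G : E →L[ℝ] E →L[ℝ] ℝ := g.inner x
  G.bilinearComp A A

/-- Christoffel symbols of the first kind in the preferred chart at `p`, as the linear form
`w ↦ 1/2 (∂_u G (v, w) + ∂_v G (u, w) - ∂_w G (u, v))`, where `G` is the metric in the chart. -/
def christoffelFirst (g : Metric E M) (p : M) (y u v : E) : E →L[ℝ] ℝ :=
  let G : E → E →L[ℝ] E →L[ℝ] ℝ := metricInChart g p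
  (1 / 2 : ℝ) •
    (fderiv ℝ (fun z => G z v) y u + fderiv ℝ (fun z => G z u) y v - fderiv ℝ (fun z => G z u v) y)

/-- Christoffel symbols (of the second kind) of the Levi-Civita connection in the preferred chart
at `p`: `christoffel g p y u v` is the vector `Γ(u, v)` with `G (Γ(u, v), w) = Γ₁(u, v)(w)`. -/
def christoffel (g : Metric E M) (p : M) (y u v : E) : E :=
  (metricInChart g p y).inverse (christoffelFirst g p y u v)

/-- The velocity `γ'` of a curve `γ` defined on the interval `S`. -/
def velocity (γ : ℝ → M) (S : Set ℝ) (t : ℝ) : TangentSpace 𝓘(ℝ, E) (γ t) :=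
  mfderivWithin 𝓘(ℝ, ℝ) 𝓘(ℝ, E) γ S t (1 : ℝ)

/-- Coordinates, in the preferred chart at `p`, of a vector field `V` along `γ`. -/
def fieldInChart (p : M) (γ : ℝ → M) (V : Π t : ℝ, TangentSpace 𝓘(ℝ, E) (γ t)) (t : ℝ) : E :=
  mfderiv 𝓘(ℝ, E) 𝓘(ℝ, E) (extChartAt 𝓘(ℝ, E) p) (γ t) (V t)

/-- The covariant derivative `∇_{γ'} V` at the parameter `t`, of a vector field `V` along the curve
`γ`, for the Levi-Civita connection `∇` of `g`. In the preferred chart at `γ t` it has the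
coordinates `V' + Γ(γ', V)`. -/
def covDerivAlong (g : Metric E M) (γ : ℝ → M) (S : Set ℝ)
    (V : Π t : ℝ, TangentSpace 𝓘(ℝ, E) (γ t)) (t : ℝ) : TangentSpace 𝓘(ℝ, E) (γ t) :=
  let ψ := extChartAt 𝓘(ℝ, E) (γ t)
  let W : E := derivWithin (fieldInChart (γ t) γ V) S t
    + christoffel g (γ t) (ψ (γ t))
        (fieldInChart (γ t) γ (velocity γ S) t) (fieldInChart (γ t) γ V t)
  (mfderiv 𝓘(ℝ, E) 𝓘(ℝ, E) ψ (γ t)).inverse W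

/-! ### Curves -/

/-- `V` is a smooth vector field along the curve `γ` on `S`. -/
def SmoothAlong (γ : ℝ → M) (S : Set ℝ) (V : Π t : ℝ, TangentSpace 𝓘(ℝ, E) (γ t)) : Prop :=
  ContMDiffOn 𝓘(ℝ, ℝ) (𝓘(ℝ, E).prod 𝓘(ℝ, E)) ∞
    (fun t : ℝ => TotalSpace.mk' E (E := (TangentSpace 𝓘(ℝ, E) : M → Type _)) (γ t) (V t)) S

/-- `γ` is a smooth unit-speed curve on `S`. -/
structure IsUnitSpeed (g : Metric E M) (γ : ℝ → M) (S : Set ℝ) : Prop where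
  smooth : ContMDiffOn 𝓘(ℝ, ℝ) 𝓘(ℝ, E) ∞ γ S
  unit : ∀ t ∈ S, g.inner (γ t) (velocity γ S t) (velocity γ S t) = 1

/-- `γ` is a Frenet curve of osculating order `r` on `S`, with Frenet frame
`T = v 1, v 2, …, v r` and curvatures `κ 1, …, κ (r - 1)` (the values of `v` and `κ` at other
indices are irrelevant). -/
structure IsFrenet (g : Metric E M) (γ : ℝ → M) (S : Set ℝ) (r : ℕ)
    (v : ℕ → Π t : ℝ, TangentSpace 𝓘(ℝ, E) (γ t)) (κ : ℕ → ℝ → ℝ) : Prop where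
  one_le : 1 ≤ r
  le_dim : r ≤ Module.finrank ℝ E
  smooth : ∀ i ∈ Finset.Icc 1 r, SmoothAlong γ S (v i)
  orthonormal : ∀ i ∈ Finset.Icc 1 r, ∀ j ∈ Finset.Icc 1 r, ∀ t ∈ S,
    g.inner (γ t) (v i t) (v j t) = if i = j then 1 else 0
  tangent : ∀ t ∈ S, v 1 t = velocity γ S t
  curvature_pos : ∀ i, 1 ≤ i → i < r → ∀ t ∈ S, 0 < κ i t
  frenet : ∀ i ∈ Finset.Icc 1 r, ∀ t ∈ S,
    covDerivAlong g γ S (v i) t =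
      (if i = 1 then 0 else -(κ (i - 1) t • v (i - 1) t))
        + (if i = r then 0 else κ i t • v (i + 1) t)

/-- A curve is Legendre if its velocity is `g`-orthogonal to all the `ξ_α`. -/
def IsLegendre {s : ℕ} (F : FramedStructure E M s) (γ : ℝ → M) (S : Set ℝ) : Prop :=
  ∀ α, ∀ t ∈ S, F.g.inner (γ t) (velocity γ S t) (F.ξ α (γ t)) = 0

end FramedGeometry

end

/-!
Each `ξ_α` of a C-structure is parallel, and this forces the conclusion.

* `φ` and the `η^α` are invariant under the flow of `ξ_β`. For `η^α` this is Cartan's formula, as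
  `dη^α = 0` and `η^α(ξ_β)` is constant. For `φ`, normality and `dη = 0` give `N_φ = 0`, so that
  `φ (φ [X, ξ_β] - [φ X, ξ_β]) = 0`, while every `η^α` kills the vector in brackets; together
  these say that this vector vanishes (`IsCStructure.mlieBracket_ξ_φ`).
* `Ω` is invariant too: `dΩ = 0`, and `ξ_β` is in the kernel of `Ω`. Since
  `g (X, Y) = Ω (φ X, Y) + ∑ η^α(X) η^α(Y)`, the metric is invariant, that is, `ξ_β` is a Killing
  field (`IsCStructure.killing`).
* The covariant derivative of a Killing field is skew-symmetric, and that of the dual of a closed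
  form is symmetric. Hence `∇ ξ_α = 0` (`IsCStructure.parallel_chart`). As `∇` is given by
  Christoffel symbols, this step is carried out in the preferred chart at a point, with both
  properties tested on fields with constant coordinates.
* Consequently `g (V, ξ_α)' = g (∇_T V, ξ_α)` for every field `V` along `γ`
  (`IsCStructure.hasDerivWithinAt_inner_ξ`). If `ξ_α` is orthogonal to `v_1, …, v_i` along `γ` and
  `i < r`, then the Frenet equation for `v_i` gives `κ_i g (v_{i+1}, ξ_α) = 0`, and `κ_i > 0`. The
  induction starts with the Legendre condition `g (T, ξ_α) = 0`.
-/

noncomputable section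

namespace FramedGeometry

/-! ### Calculus in normed spaces -/

lemma _root_.HasDerivWithinAt.clm_apply_apply_comp {V W : Type*} [NormedAddCommGroup V]
    [NormedSpace ℝ V] [NormedAddCommGroup W] [NormedSpace ℝ W] {G : V → V →L[ℝ] V →L[ℝ] W}
    {X : V → V} {c v : ℝ → V} {c' v' : V} {S : Set ℝ} {t : ℝ} (hG : DifferentiableAt ℝ G (c t))
    (hX : DifferentiableAt ℝ X (c t)) (hc : HasDerivWithinAt c c' S t)
    (hv : HasDerivWithinAt v v' S t) :
    HasDerivWithinAt (fun τ => G (c τ) (v τ) (X (c τ)))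
      (fderiv ℝ G (c t) c' (v t) (X (c t)) + G (c t) v' (X (c t))
        + G (c t) (v t) (fderiv ℝ X (c t) c')) S t := by
  have h1 : HasDerivWithinAt (fun τ => G (c τ)) (fderiv ℝ G (c t) c') S t :=
    HasFDerivAt.comp_hasDerivWithinAt (F := V) (E := V →L[ℝ] V →L[ℝ] W) t hG.hasFDerivAt hc
  have h2 : HasDerivWithinAt (fun τ => X (c τ)) (fderiv ℝ X (c t) c') S t :=
    hX.hasFDerivAt.comp_hasDerivWithinAt t hc
  simpa using (h1.clm_apply hv).clm_apply h2

/-- A family of continuous linear maps on a finite-dimensional space is `C^n` at a point if all its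
evaluations are. -/
theorem contDiffAt_clm_of_apply {D F G : Type*} [NormedAddCommGroup D] [NormedSpace ℝ D]
    [NormedAddCommGroup F] [NormedSpace ℝ F] [FiniteDimensional ℝ F]
    [NormedAddCommGroup G] [NormedSpace ℝ G] {n : WithTop ℕ∞}
    {f : D → F →L[ℝ] G} {x : D} (h : ∀ y, ContDiffAt ℝ n (fun x => f x y) x) :
    ContDiffAt ℝ n f x := by
  let e₁ : F ≃L[ℝ] (Fin (Module.finrank ℝ F) → ℝ) :=
    ContinuousLinearEquiv.ofFinrankEq (Module.finrank_fin_fun ℝ).symm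
  let e₂ := (e₁.arrowCongr (1 : G ≃L[ℝ] G)).trans (ContinuousLinearEquiv.piRing (Fin _))
  rw [← Function.id_comp f, ← e₂.symm_comp_self]
  exact e₂.symm.contDiff.contDiffAt.comp x (contDiffAt_pi.mpr fun i => h _)

/-! ### Directional derivatives of functions -/

variable {E : Type*} [NormedAddCommGroup E] [NormedSpace ℝ E]
  {M : Type*} [TopologicalSpace M] [ChartedSpace E M]

section dirDeriv

variable {X : Π y : M, TangentSpace 𝓘(ℝ, E) y} {f f' : M → ℝ} {x : M}

lemma dirDeriv_const (c : ℝ) : dirDeriv X (fun _ => c) x = 0 := by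
  rw [dirDeriv, mfderiv_const]
  rfl

lemma dirDeriv_sub (hf : MDifferentiableAt 𝓘(ℝ, E) 𝓘(ℝ, ℝ) f x)
    (hf' : MDifferentiableAt 𝓘(ℝ, E) 𝓘(ℝ, ℝ) f' x) :
    dirDeriv X (fun y => f y - f' y) x = dirDeriv X f x - dirDeriv X f' x := by
  have := (hf.hasMFDerivAt.sub hf'.hasMFDerivAt).mfderiv
  exact DFunLike.congr_fun this (X x)

lemma dirDeriv_mul (hf : MDifferentiableAt 𝓘(ℝ, E) 𝓘(ℝ, ℝ) f x)
    (hf' : MDifferentiableAt 𝓘(ℝ, E) 𝓘(ℝ, ℝ) f' x) :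
    dirDeriv X (fun y => f y * f' y) x = f x * dirDeriv X f' x + dirDeriv X f x * f' x := by
  have := (hf.hasMFDerivAt.mul' hf'.hasMFDerivAt).mfderiv
  exact DFunLike.congr_fun this (X x)

lemma dirDeriv_add (hf : MDifferentiableAt 𝓘(ℝ, E) 𝓘(ℝ, ℝ) f x)
    (hf' : MDifferentiableAt 𝓘(ℝ, E) 𝓘(ℝ, ℝ) f' x) :
    dirDeriv X (fun y => f y + f' y) x = dirDeriv X f x + dirDeriv X f' x := by
  have := (hf.hasMFDerivAt.add hf'.hasMFDerivAt).mfderiv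
  exact DFunLike.congr_fun this (X x)

lemma mdifferentiableAt_sum {ι : Type*} {t : Finset ι} {f : ι → M → ℝ}
    (hf : ∀ i ∈ t, MDifferentiableAt 𝓘(ℝ, E) 𝓘(ℝ, ℝ) (f i) x) :
    MDifferentiableAt 𝓘(ℝ, E) 𝓘(ℝ, ℝ) (fun y => ∑ i ∈ t, f i y) x := by
  induction t using Finset.cons_induction with
  | empty => simpa using mdifferentiableAt_const
  | cons i t hi ih =>
    rw [Finset.forall_mem_cons] at hf
    simp only [Finset.sum_cons]
    exact hf.1.add (ih hf.2)

lemma dirDeriv_sum {ι : Type*} {t : Finset ι} {f : ι → M → ℝ}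
    (hf : ∀ i ∈ t, MDifferentiableAt 𝓘(ℝ, E) 𝓘(ℝ, ℝ) (f i) x) :
    dirDeriv X (fun y => ∑ i ∈ t, f i y) x = ∑ i ∈ t, dirDeriv X (f i) x := by
  induction t using Finset.cons_induction with
  | empty => simpa using dirDeriv_const 0
  | cons i t hi ih =>
    rw [Finset.forall_mem_cons] at hf
    simp only [Finset.sum_cons, ← ih hf.2]
    exact dirDeriv_add hf.1 (mdifferentiableAt_sum hf.2)

end dirDeriv

lemma dirDeriv_eq_fderiv {X : Π y : M, TangentSpace 𝓘(ℝ, E) y} {f : M → ℝ} {p : M}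
    (hf : MDifferentiableAt 𝓘(ℝ, E) 𝓘(ℝ, ℝ) f p) :
    dirDeriv X f p =
      fderiv ℝ (f ∘ (extChartAt 𝓘(ℝ, E) p).symm) (extChartAt 𝓘(ℝ, E) p p) (X p) := by
  simp only [dirDeriv, mfderiv, hf, modelWithCornersSelf_coe, Set.range_id,
    fderivWithin_univ]
  rfl

/-- Near `ψ p`, where `ψ` is the preferred chart at `p`, every point is `ψ x` for some `x` in the
source of `ψ`, so a property may be checked at such points. -/
lemma eventually_chart {p : M} {P : E → Prop} (h : ∀ x ∈ (extChartAt 𝓘(ℝ, E) p).source,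
    P (extChartAt 𝓘(ℝ, E) p x)) : ∀ᶠ z in nhds (extChartAt 𝓘(ℝ, E) p p), P z := by
  filter_upwards [extChartAt_target_mem_nhds (I := 𝓘(ℝ, E)) p] with z hz
  have := h _ ((extChartAt 𝓘(ℝ, E) p).map_target hz)
  rwa [(extChartAt 𝓘(ℝ, E) p).right_inv hz] at this

variable [IsManifold 𝓘(ℝ, E) ∞ M]

/-! ### Smoothness of tensors evaluated on fields -/

lemma contMDiffAt_inner (g : Metric E M) {X Y : Π y : M, TangentSpace 𝓘(ℝ, E) y} {x : M}
    (hX : SmoothFieldAt X x) (hY : SmoothFieldAt Y x) :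
    ContMDiffAt 𝓘(ℝ, E) 𝓘(ℝ, ℝ) ∞ (fun y => g.inner y (X y) (Y y)) x := by
  have h : ContMDiffAt 𝓘(ℝ, E) (𝓘(ℝ, E).prod 𝓘(ℝ, ℝ)) ∞
      (fun y : M => TotalSpace.mk' ℝ (E := Trivial M ℝ) y (g.inner y (X y) (Y y))) x :=
    ContMDiffAt.clm_bundle_apply₂ (F₁ := E) (F₂ := E) (b := fun y : M => y)
      (ψ := g.inner) g.contMDiff.contMDiffAt hX hY
  simp only [contMDiffAt_totalSpace] at h
  exact h.2

lemma SmoothFieldAt.clm_apply {φ : Π x : M, TangentSpace 𝓘(ℝ, E) x →L[ℝ] TangentSpace 𝓘(ℝ, E) x}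
    {x : M} {X : Π y : M, TangentSpace 𝓘(ℝ, E) y}
    (hφ : ContMDiffAt 𝓘(ℝ, E) (𝓘(ℝ, E).prod 𝓘(ℝ, E →L[ℝ] E)) ∞
    (fun x : M => TotalSpace.mk' (E →L[ℝ] E)
      (E := fun x : M => TangentSpace 𝓘(ℝ, E) x →L[ℝ] TangentSpace 𝓘(ℝ, E) x) x (φ x)) x)
    (hX : SmoothFieldAt X x) : SmoothFieldAt (fun y => φ y (X y)) x :=
  ContMDiffAt.clm_bundle_apply hφ hX

/-! ### Lie derivatives along the structure fields -/

namespace FramedStructure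

variable {s : ℕ} {F : FramedStructure E M s} {x : M} {X Y : Π y : M, TangentSpace 𝓘(ℝ, E) y}

/-- `φ` is skew-symmetric for `g`. -/
lemma inner_φ_right (F : FramedStructure E M s) (x : M) (u v : TangentSpace 𝓘(ℝ, E) x) :
    F.g.inner x u (F.φ x v) = - F.g.inner x (F.φ x u) v := by
  have h := F.g_φ x u (F.φ x v)
  have h' : F.g.inner x (F.φ x u) (F.φ x (F.φ x v)) = - F.g.inner x (F.φ x u) v := by
    rw [F.φ_sq]
    simp [map_sum, ← F.η_eq, F.η_φ]
  simp only [F.η_φ, mul_zero, Finset.sum_const_zero, sub_zero] at h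
  rw [← h, h']

lemma mdifferentiableAt_η (F : FramedStructure E M s) (α : Fin s) (hX : SmoothFieldAt X x) :
    MDifferentiableAt 𝓘(ℝ, E) 𝓘(ℝ, ℝ) (fun y => F.η α y (X y)) x := by
  simp only [F.η_eq]
  exact (contMDiffAt_inner F.g hX (F.smooth_ξ α x)).mdifferentiableAt (by simp)

lemma smoothFieldAt_φ (F : FramedStructure E M s) (hX : SmoothFieldAt X x) :
    SmoothFieldAt (fun y => F.φ y (X y)) x :=
  SmoothFieldAt.clm_apply F.smooth_φ.contMDiffAt hX

/-- Since `dη^α = 0` and `η^α(ξ_β)` is constant, `η^α` is invariant under the flow of `ξ_β`. -/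
lemma IsCStructure.dirDeriv_η (hF : F.IsCStructure) (α β : Fin s) (hX : SmoothFieldAt X x) :
    dirDeriv (F.ξ β) (fun y => F.η α y (X y)) x =
      F.η α x (mlieBracket 𝓘(ℝ, E) (F.ξ β) X x) := by
  have h := hF.closed_η α x (F.ξ β) X (F.smooth_ξ β x) hX
  simp only [extDerivOne, F.η_ξ, dirDeriv_const] at h
  linarith

/-- `φ` is invariant under the flow of `ξ_β`. -/
lemma IsCStructure.mlieBracket_ξ_φ (hF : F.IsCStructure) (β : Fin s) (hX : SmoothFieldAt X x) :
    mlieBracket 𝓘(ℝ, E) (F.ξ β) (fun y => F.φ y (X y)) x =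
      F.φ x (mlieBracket 𝓘(ℝ, E) (F.ξ β) X x) := by
  have hN := hF.normal x (F.ξ β) X (F.smooth_ξ β x) hX
  have h0 : (fun y => F.φ y (F.ξ β y)) = 0 := by ext y; exact F.φ_ξ y β
  simp only [hF.closed_η _ x (F.ξ β) X (F.smooth_ξ β x) hX, nijenhuis, h0,
    mlieBracket_zero_left, zero_smul, Finset.sum_const_zero, smul_zero, Pi.zero_apply, map_zero,
    add_zero, sub_zero] at hN
  have hη : ∀ α, F.η α x (mlieBracket 𝓘(ℝ, E) (F.ξ β) (fun y => F.φ y (X y)) x) = 0 := fun α => by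
    rw [← hF.dirDeriv_η α β (F.smoothFieldAt_φ hX)]
    simp only [F.η_φ, dirDeriv_const]
  -- the difference `D` of the two sides satisfies `φ D = 0` and `η^α D = 0`, and `φ² = -1` there
  have h1 := congrArg (F.φ x) hN
  rw [map_sub, map_zero, F.φ_sq, F.φ_sq] at h1
  simp only [F.η_φ, hη, zero_smul, Finset.sum_const_zero, add_zero] at h1
  rw [sub_neg_eq_add, neg_add_eq_zero] at h1
  exact h1.symm

/-- `Ω` is invariant under the flow of `ξ_β`. -/
lemma IsCStructure.dirDeriv_Ω (hF : F.IsCStructure) (β : Fin s)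
    (hX : SmoothFieldAt X x) (hY : SmoothFieldAt Y x) :
    dirDeriv (F.ξ β) (fun y => F.Ω y (X y) (Y y)) x =
      F.Ω x (mlieBracket 𝓘(ℝ, E) (F.ξ β) X x) (Y x)
        + F.Ω x (X x) (mlieBracket 𝓘(ℝ, E) (F.ξ β) Y x) := by
  have h := hF.closed_Ω x (F.ξ β) X Y (F.smooth_ξ β x) hX hY
  have h1 : ∀ y v, F.Ω y v (F.ξ β y) = 0 := fun y v => by simp [Ω, F.φ_ξ]
  have h2 : ∀ y v, F.Ω y (F.ξ β y) v = 0 := fun y v => by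
    rw [Ω, F.g.symm, ← F.η_eq, F.η_φ]
  have h3 : F.Ω x (mlieBracket 𝓘(ℝ, E) Y (F.ξ β) x) (X x) =
      F.Ω x (X x) (mlieBracket 𝓘(ℝ, E) (F.ξ β) Y x) := by
    rw [mlieBracket_swap_apply, Ω, Ω, F.inner_φ_right x (X x)]
    rw [F.g.symm x (F.φ x (X x))]
    simp
  simp only [extDerivTwo, h1, h2, dirDeriv_const, h3] at h
  linarith

/-- The fields `ξ_β` of a C-structure are Killing fields: the Lie derivative of `g` along `ξ_β`
vanishes. -/
lemma IsCStructure.killing (hF : F.IsCStructure) (β : Fin s)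
    (hX : SmoothFieldAt X x) (hY : SmoothFieldAt Y x) :
    dirDeriv (F.ξ β) (fun y => F.g.inner y (X y) (Y y)) x =
      F.g.inner x (mlieBracket 𝓘(ℝ, E) (F.ξ β) X x) (Y x)
        + F.g.inner x (X x) (mlieBracket 𝓘(ℝ, E) (F.ξ β) Y x) := by
  -- `Ω (φ X, Y) = g (φ X, φ Y) = g (X, Y) - ∑ η^α(X) η^α(Y)`
  have h := hF.dirDeriv_Ω β (F.smoothFieldAt_φ hX) hY
  simp only [Ω, F.g_φ, hF.mlieBracket_ξ_φ β hX] at h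
  have hXY := (contMDiffAt_inner F.g hX hY).mdifferentiableAt (by simp)
  have hs : ∀ α ∈ Finset.univ, MDifferentiableAt 𝓘(ℝ, E) 𝓘(ℝ, ℝ)
      (fun y => F.η α y (X y) * F.η α y (Y y)) x := fun α _ =>
    (F.mdifferentiableAt_η α hX).mul (F.mdifferentiableAt_η α hY)
  rw [dirDeriv_sub hXY, dirDeriv_sum hs] at h
  · simp only [dirDeriv_mul (F.mdifferentiableAt_η _ hX) (F.mdifferentiableAt_η _ hY),
      hF.dirDeriv_η _ β hX, hF.dirDeriv_η _ β hY, Finset.sum_add_distrib] at h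
    linarith
  · exact mdifferentiableAt_sum hs

end FramedStructure

/-! ### Fields and brackets in the preferred chart -/

section chart

variable {p x : M}

/-- The differential at `x` of the preferred chart at `p`, given by the trivialization of the tangent
bundle at `p`. It agrees with the `mfderiv` of the chart only on the chart source; elsewhere it is
zero. -/
def chartDeriv (p x : M) : TangentSpace 𝓘(ℝ, E) x →L[ℝ] E :=
  (trivializationAt E (TangentSpace 𝓘(ℝ, E)) p).continuousLinearMapAt ℝ x

/-- The vector field with constant coordinates `u` in the preferred chart at `p`; it is zero outside
the source of the chart. -/
def coordField (p : M) (u : E) (y : M) : TangentSpace 𝓘(ℝ, E) y :=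
  (trivializationAt E (TangentSpace 𝓘(ℝ, E)) p).symmL ℝ y u

/-- The coordinates of the vector field `X` in the preferred chart at `p`, as a function of the
coordinates of the point. -/
def chartRep (p : M) (X : Π y : M, TangentSpace 𝓘(ℝ, E) y) (z : E) : E :=
  chartDeriv p ((extChartAt 𝓘(ℝ, E) p).symm z) (X ((extChartAt 𝓘(ℝ, E) p).symm z))

lemma mem_baseSet (hx : x ∈ (extChartAt 𝓘(ℝ, E) p).source) :
    x ∈ (trivializationAt E (TangentSpace 𝓘(ℝ, E)) p).baseSet := by
  simpa using hx

lemma mfderiv_extChartAt_apply (hx : x ∈ (extChartAt 𝓘(ℝ, E) p).source)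
    (v : TangentSpace 𝓘(ℝ, E) x) :
    mfderiv 𝓘(ℝ, E) 𝓘(ℝ, E) (extChartAt 𝓘(ℝ, E) p) x v = chartDeriv p x v := by
  rw [chartDeriv, TangentBundle.continuousLinearMapAt_trivializationAt (by simpa using hx)]
  rfl

/-- In Mathlib the tangent space at `p` is the model space, identified through the preferred chart
at `p`, so the differential of that chart at `p` is the identity. -/
lemma chartDeriv_self (v : TangentSpace 𝓘(ℝ, E) p) : chartDeriv p p v = v := by
  rw [← mfderiv_extChartAt_apply (mem_extChartAt_source p), mfderiv_extChartAt_self]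
  rfl

lemma chartDeriv_coordField (hx : x ∈ (extChartAt 𝓘(ℝ, E) p).source) (u : E) :
    chartDeriv p x (coordField p u x) = u :=
  (trivializationAt E (TangentSpace 𝓘(ℝ, E)) p).continuousLinearMapAt_symmL (mem_baseSet hx) u

lemma coordField_chartDeriv (hx : x ∈ (extChartAt 𝓘(ℝ, E) p).source)
    (v : TangentSpace 𝓘(ℝ, E) x) : coordField p (chartDeriv p x v) x = v :=
  (trivializationAt E (TangentSpace 𝓘(ℝ, E)) p).symmL_continuousLinearMapAt (mem_baseSet hx) v

lemma metricInChart_apply (g : Metric E M) (hx : x ∈ (extChartAt 𝓘(ℝ, E) p).source) (u v : E) :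
    metricInChart g p (extChartAt 𝓘(ℝ, E) p x) u v =
      g.inner x (coordField p u x) (coordField p v x) := by
  have h : ∀ u : E, coordField p u x = (mfderiv 𝓘(ℝ, E) 𝓘(ℝ, E) (extChartAt 𝓘(ℝ, E) p).symm
      (extChartAt 𝓘(ℝ, E) p x) : E →L[ℝ] E) u := fun u => by
    have h := TangentBundle.symmL_trivializationAt (I := 𝓘(ℝ, E)) (x₀ := p) (x := x)
      (by simpa using hx)
    simp only [modelWithCornersSelf_coe, Set.range_id, mfderivWithin_univ] at h
    exact DFunLike.congr_fun h u
  rw [h, h]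
  have hG : ∀ y : M, y = x → ∀ a b : E, (g.inner y : E →L[ℝ] E →L[ℝ] ℝ) a b =
      (g.inner x : E →L[ℝ] E →L[ℝ] ℝ) a b := by
    rintro y rfl a b; rfl
  exact hG _ ((extChartAt 𝓘(ℝ, E) p).left_inv hx) _ _

lemma metricInChart_chartDeriv (g : Metric E M) (hx : x ∈ (extChartAt 𝓘(ℝ, E) p).source)
    (v w : TangentSpace 𝓘(ℝ, E) x) :
    metricInChart g p (extChartAt 𝓘(ℝ, E) p x) (chartDeriv p x v) (chartDeriv p x w) =
      g.inner x v w := by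
  rw [metricInChart_apply g hx, coordField_chartDeriv hx, coordField_chartDeriv hx]

lemma chartRep_apply (X : Π y : M, TangentSpace 𝓘(ℝ, E) y)
    (hx : x ∈ (extChartAt 𝓘(ℝ, E) p).source) :
    chartRep p X (extChartAt 𝓘(ℝ, E) p x) = chartDeriv p x (X x) := by
  rw [chartRep, (extChartAt 𝓘(ℝ, E) p).left_inv hx]

lemma chartRep_self (X : Π y : M, TangentSpace 𝓘(ℝ, E) y) :
    chartRep p X (extChartAt 𝓘(ℝ, E) p p) = chartDeriv p p (X p) :=
  chartRep_apply X (mem_extChartAt_source p)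

lemma chartRep_coordField (u : E) :
    chartRep p (coordField p u) =ᶠ[nhds (extChartAt 𝓘(ℝ, E) p p)] fun _ => u :=
  eventually_chart fun x hx => by rw [chartRep_apply _ hx, chartDeriv_coordField hx]

lemma smoothFieldAt_iff {X : Π y : M, TangentSpace 𝓘(ℝ, E) y} :
    SmoothFieldAt X p ↔ ContMDiffAt 𝓘(ℝ, E) 𝓘(ℝ, E) ∞ (fun x => chartDeriv p x (X x)) p := by
  have h : (fun x => chartDeriv p x (X x)) =ᶠ[nhds p] fun x =>
      (trivializationAt E (TangentSpace 𝓘(ℝ, E)) p ⟨x, X x⟩).2 := by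
    filter_upwards [extChartAt_source_mem_nhds (I := 𝓘(ℝ, E)) p] with x hx
    rw [chartDeriv, Bundle.Trivialization.continuousLinearMapAt_apply,
      Bundle.Trivialization.coe_linearMapAt_of_mem _ (mem_baseSet hx)]
  rw [SmoothFieldAt, contMDiffAt_totalSpace, h.contMDiffAt_iff]
  exact and_iff_right contMDiffAt_id

lemma smoothFieldAt_coordField (p : M) (u : E) : SmoothFieldAt (coordField p u) p := by
  rw [smoothFieldAt_iff]
  refine contMDiffAt_const (c := u) |>.congr_of_eventuallyEq ?_
  filter_upwards [extChartAt_source_mem_nhds (I := 𝓘(ℝ, E)) p] with x hx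
  exact chartDeriv_coordField hx u

lemma contDiffAt_chartRep {X : Π y : M, TangentSpace 𝓘(ℝ, E) y} (hX : SmoothFieldAt X p) :
    ContDiffAt ℝ ∞ (chartRep p X) (extChartAt 𝓘(ℝ, E) p p) := by
  have h := (contMDiffAt_iff.1 (smoothFieldAt_iff.1 hX)).2
  simp only [modelWithCornersSelf_coe, Set.range_id, contDiffWithinAt_univ] at h
  exact h

lemma mlieBracket_eq (X Y : Π y : M, TangentSpace 𝓘(ℝ, E) y) :
    mlieBracket 𝓘(ℝ, E) X Y p =
      lieBracket ℝ (chartRep p X) (chartRep p Y) (extChartAt 𝓘(ℝ, E) p p) := by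
  have h : ∀ X : Π y : M, TangentSpace 𝓘(ℝ, E) y,
      mpullbackWithin 𝓘(ℝ, E) 𝓘(ℝ, E) (extChartAt 𝓘(ℝ, E) p).symm X (Set.range 𝓘(ℝ, E))
        =ᶠ[nhds (extChartAt 𝓘(ℝ, E) p p)] chartRep p X := fun X => by
    filter_upwards [extChartAt_target_mem_nhds (I := 𝓘(ℝ, E)) p] with z hz
    have hx := (extChartAt 𝓘(ℝ, E) p).map_target hz
    rw [mpullbackWithin_apply, chartRep, ← mfderiv_extChartAt_apply hx]
    have h1 := mfderiv_extChartAt_comp_mfderivWithin_extChartAt_symm hz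
    have h2 := mfderivWithin_extChartAt_symm_comp_mfderiv_extChartAt hz
    rw [ContinuousLinearMap.inverse_eq h2 h1]
    rfl
  rw [← mlieBracketWithin_univ, mlieBracketWithin_apply, mfderiv_extChartAt_self,
    Set.preimage_univ, Set.univ_inter]
  rw [← (h X).lieBracket_vectorField_eq (h Y), ModelWithCorners.range_eq_univ]
  exact (DFunLike.congr_fun ContinuousLinearMap.inverse_id _).trans
    (congrFun (lieBracketWithin_univ (E := E)) _)

lemma mlieBracket_coordField_right (X : Π y : M, TangentSpace 𝓘(ℝ, E) y) (u : E) :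
    chartDeriv p p (mlieBracket 𝓘(ℝ, E) X (coordField p u) p) =
      -(fderiv ℝ (chartRep p X) (extChartAt 𝓘(ℝ, E) p p) u) := by
  rw [chartDeriv_self, mlieBracket_eq, lieBracket, (chartRep_coordField u).fderiv_eq,
    (chartRep_coordField u).eq_of_nhds, fderiv_fun_const]
  exact zero_sub _

lemma mlieBracket_coordField_coordField (u v : E) :
    mlieBracket 𝓘(ℝ, E) (coordField p v) (coordField p u) p = 0 := by
  rw [← chartDeriv_self (mlieBracket _ _ _ _), mlieBracket_coordField_right,
    (chartRep_coordField v).fderiv_eq, fderiv_fun_const]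
  exact neg_zero

lemma inner_comp_symm (g : Metric E M) (X Y : Π y : M, TangentSpace 𝓘(ℝ, E) y) :
    (fun y => g.inner y (X y) (Y y)) ∘ (extChartAt 𝓘(ℝ, E) p).symm
      =ᶠ[nhds (extChartAt 𝓘(ℝ, E) p p)]
    fun z => metricInChart g p z (chartRep p X z) (chartRep p Y z) :=
  eventually_chart fun x hx => by
    beta_reduce
    rw [chartRep_apply _ hx, chartRep_apply _ hx, metricInChart_chartDeriv g hx, Function.comp,
      (extChartAt 𝓘(ℝ, E) p).left_inv hx]

lemma dirDeriv_inner (g : Metric E M) (W : Π y : M, TangentSpace 𝓘(ℝ, E) y)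
    {X Y : Π y : M, TangentSpace 𝓘(ℝ, E) y}
    (hX : SmoothFieldAt X p) (hY : SmoothFieldAt Y p) :
    dirDeriv W (fun y => g.inner y (X y) (Y y)) p =
      fderiv ℝ (fun z => metricInChart g p z (chartRep p X z) (chartRep p Y z))
        (extChartAt 𝓘(ℝ, E) p p) (chartDeriv p p (W p)) := by
  rw [chartDeriv_self, dirDeriv_eq_fderiv ((contMDiffAt_inner g hX hY).mdifferentiableAt (by simp)),
    (inner_comp_symm g X Y).fderiv_eq]

lemma contDiffAt_metricInChart [FiniteDimensional ℝ E] (g : Metric E M) (p : M) :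
    ContDiffAt ℝ ∞ (metricInChart g p) (extChartAt 𝓘(ℝ, E) p p) := by
  refine contDiffAt_clm_of_apply fun u => contDiffAt_clm_of_apply fun v => ?_
  have h := contMDiffAt_inner g (smoothFieldAt_coordField p u) (smoothFieldAt_coordField p v)
  have h1 := (contMDiffAt_iff.1 h).2
  simp only [modelWithCornersSelf_coe, Set.range_id, contDiffWithinAt_univ] at h1
  refine ContDiffAt.congr_of_eventuallyEq h1 ?_
  filter_upwards [inner_comp_symm (p := p) g (coordField p u) (coordField p v),
    chartRep_coordField (p := p) u, chartRep_coordField (p := p) v] with z h1 h2 h3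
  rw [h2, h3] at h1
  exact h1.symm

end chart

/-! ### Christoffel symbols -/

variable [FiniteDimensional ℝ E]

section christoffel

variable (g : Metric E M) {p : M}

omit [FiniteDimensional ℝ E] in
lemma inner_eq_metricInChart (u v : TangentSpace 𝓘(ℝ, E) p) :
    g.inner p u v =
      metricInChart g p (extChartAt 𝓘(ℝ, E) p p) (chartDeriv p p u) (chartDeriv p p v) :=
  (metricInChart_chartDeriv g (mem_extChartAt_source p) u v).symm

omit [FiniteDimensional ℝ E] in
lemma metricInChart_symm (u v : E) :
    metricInChart g p (extChartAt 𝓘(ℝ, E) p p) u v =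
      metricInChart g p (extChartAt 𝓘(ℝ, E) p p) v u := by
  rw [metricInChart_apply g (mem_extChartAt_source p), g.symm,
    ← metricInChart_apply g (mem_extChartAt_source p)]

/-- Positivity of `g` makes the metric in the chart invertible, so that the inverse which defines
`christoffel` is not a junk value. -/
lemma metricInChart_christoffel (u v w : E) :
    metricInChart g p (extChartAt 𝓘(ℝ, E) p p)
      (christoffel g p (extChartAt 𝓘(ℝ, E) p p) u v) w =
      christoffelFirst g p (extChartAt 𝓘(ℝ, E) p p) u v w := by
  set G := metricInChart g p (extChartAt 𝓘(ℝ, E) p p) with hG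
  have hinj : Function.Injective (G : E →ₗ[ℝ] E →L[ℝ] ℝ) := by
    rw [injective_iff_map_eq_zero]
    intro a ha
    by_contra h0
    have h1 : 0 < g.inner p (coordField p a p) (coordField p a p) := by
      refine g.pos p _ fun h => h0 ?_
      rw [← chartDeriv_coordField (mem_extChartAt_source p) a, h, map_zero]
    rw [inner_eq_metricInChart, chartDeriv_coordField (mem_extChartAt_source p), ← hG] at h1
    have h2 : G a a = 0 := by rw [show G a = 0 from ha]; rfl
    exact h1.ne' h2
  have hdim : Module.finrank ℝ E = Module.finrank ℝ (E →L[ℝ] ℝ) := by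
    rw [← (LinearMap.toContinuousLinearMap (𝕜 := ℝ) (E := E) (F' := ℝ)).finrank_eq]
    exact (Subspace.dual_finrank_eq).symm
  have hinv : G.IsInvertible :=
    ⟨(LinearEquiv.ofInjectiveOfFinrankEq (G : E →ₗ[ℝ] E →L[ℝ] ℝ) hinj hdim).toContinuousLinearEquiv,
      by ext; rfl⟩
  rw [christoffel, ← hG, hinv.self_apply_inverse]

/-- The first Christoffel symbols, through the derivative of the metric coefficients. -/
lemma christoffelFirst_apply (u v w : E) :
    christoffelFirst g p (extChartAt 𝓘(ℝ, E) p p) u v w =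
      (1 / 2 : ℝ) * (fderiv ℝ (metricInChart g p) (extChartAt 𝓘(ℝ, E) p p) u v w
        + fderiv ℝ (metricInChart g p) (extChartAt 𝓘(ℝ, E) p p) v u w
        - fderiv ℝ (metricInChart g p) (extChartAt 𝓘(ℝ, E) p p) w u v) := by
  have hd := (contDiffAt_metricInChart g p).differentiableAt (by simp)
  have h1 : ∀ a b : E, fderiv ℝ (fun z => metricInChart g p z a) (extChartAt 𝓘(ℝ, E) p p) b =
      fderiv ℝ (metricInChart g p) (extChartAt 𝓘(ℝ, E) p p) b a := fun a b => by
    rw [fderiv_clm_apply hd (differentiableAt_const a)]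
    simp
  have h2 : fderiv ℝ (fun z => metricInChart g p z u v) (extChartAt 𝓘(ℝ, E) p p) w =
      fderiv ℝ (metricInChart g p) (extChartAt 𝓘(ℝ, E) p p) w u v := by
    rw [fderiv_clm_apply (hd.clm_apply (differentiableAt_const u)) (differentiableAt_const v)]
    simp only [fderiv_fun_const, Pi.zero_apply, ContinuousLinearMap.comp_zero, zero_add,
      ContinuousLinearMap.flip_apply, h1]
  simp only [christoffelFirst, _root_.smul_apply, _root_.sub_apply,
    _root_.add_apply, h1, h2, smul_eq_mul]

end christoffel

lemma fderiv_metricInChart_apply_apply (g : Metric E M) {p : M} {a b : E → E}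
    (ha : DifferentiableAt ℝ a (extChartAt 𝓘(ℝ, E) p p))
    (hb : DifferentiableAt ℝ b (extChartAt 𝓘(ℝ, E) p p)) (w : E) :
    fderiv ℝ (fun z => metricInChart g p z (a z) (b z)) (extChartAt 𝓘(ℝ, E) p p) w =
      fderiv ℝ (metricInChart g p) (extChartAt 𝓘(ℝ, E) p p) w
          (a (extChartAt 𝓘(ℝ, E) p p)) (b (extChartAt 𝓘(ℝ, E) p p))
        + metricInChart g p (extChartAt 𝓘(ℝ, E) p p)
          (fderiv ℝ a (extChartAt 𝓘(ℝ, E) p p) w) (b (extChartAt 𝓘(ℝ, E) p p))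
        + metricInChart g p (extChartAt 𝓘(ℝ, E) p p) (a (extChartAt 𝓘(ℝ, E) p p))
          (fderiv ℝ b (extChartAt 𝓘(ℝ, E) p p) w) := by
  have hd := (contDiffAt_metricInChart g p).differentiableAt (by simp)
  rw [fderiv_clm_apply (hd.clm_apply ha) hb, fderiv_clm_apply hd ha]
  simp only [_root_.add_apply, ContinuousLinearMap.comp_apply,
    ContinuousLinearMap.flip_apply]
  ring

/-! ### The structure fields are parallel -/

namespace FramedStructure

variable {s : ℕ} {F : FramedStructure E M s}

/-- The Killing equation for `ξ_α` in coordinates. -/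
lemma IsCStructure.killing_chart (hF : F.IsCStructure) (α : Fin s) (p : M) (u v : E) :
    fderiv ℝ (metricInChart F.g p) (extChartAt 𝓘(ℝ, E) p p)
        (chartRep p (F.ξ α) (extChartAt 𝓘(ℝ, E) p p)) u v =
      -(metricInChart F.g p (extChartAt 𝓘(ℝ, E) p p)
          (fderiv ℝ (chartRep p (F.ξ α)) (extChartAt 𝓘(ℝ, E) p p) u) v)
        - metricInChart F.g p (extChartAt 𝓘(ℝ, E) p p) u
          (fderiv ℝ (chartRep p (F.ξ α)) (extChartAt 𝓘(ℝ, E) p p) v) := by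
  have h := hF.killing α (smoothFieldAt_coordField p u) (smoothFieldAt_coordField p v)
  have hu := chartRep_coordField (p := p) u
  have hv := chartRep_coordField (p := p) v
  have hdu := (contDiffAt_chartRep (smoothFieldAt_coordField p u)).differentiableAt (by simp)
  have hdv := (contDiffAt_chartRep (smoothFieldAt_coordField p v)).differentiableAt (by simp)
  rw [dirDeriv_inner F.g _ (smoothFieldAt_coordField p u) (smoothFieldAt_coordField p v),
    fderiv_metricInChart_apply_apply F.g hdu hdv, hu.fderiv_eq, hv.fderiv_eq,
    hu.eq_of_nhds, hv.eq_of_nhds, inner_eq_metricInChart, inner_eq_metricInChart,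
    mlieBracket_coordField_right, mlieBracket_coordField_right, ← chartRep_self, ← chartRep_self,
    ← chartRep_self, hu.eq_of_nhds, hv.eq_of_nhds] at h
  simp only [fderiv_fun_const, Pi.zero_apply, _root_.zero_apply, map_zero, map_neg,
    _root_.neg_apply, add_zero] at h
  rw [h, sub_eq_add_neg]

/-- The equation `dη^α = 0` in coordinates, where `η^α` is the dual of `ξ_α`. -/
lemma IsCStructure.closed_chart (hF : F.IsCStructure) (α : Fin s) (p : M) (u v : E) :
    fderiv ℝ (metricInChart F.g p) (extChartAt 𝓘(ℝ, E) p p) u v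
        (chartRep p (F.ξ α) (extChartAt 𝓘(ℝ, E) p p))
      + metricInChart F.g p (extChartAt 𝓘(ℝ, E) p p) v
        (fderiv ℝ (chartRep p (F.ξ α)) (extChartAt 𝓘(ℝ, E) p p) u) =
    fderiv ℝ (metricInChart F.g p) (extChartAt 𝓘(ℝ, E) p p) v u
        (chartRep p (F.ξ α) (extChartAt 𝓘(ℝ, E) p p))
      + metricInChart F.g p (extChartAt 𝓘(ℝ, E) p p) u
        (fderiv ℝ (chartRep p (F.ξ α)) (extChartAt 𝓘(ℝ, E) p p) v) := by
  have key : ∀ a b : E, dirDeriv (coordField p a) (fun y => F.η α y (coordField p b y)) p =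
      fderiv ℝ (metricInChart F.g p) (extChartAt 𝓘(ℝ, E) p p) a b
        (chartRep p (F.ξ α) (extChartAt 𝓘(ℝ, E) p p))
      + metricInChart F.g p (extChartAt 𝓘(ℝ, E) p p) b
        (fderiv ℝ (chartRep p (F.ξ α)) (extChartAt 𝓘(ℝ, E) p p) a) := fun a b => by
    have ha := chartRep_coordField (p := p) a
    have hb := chartRep_coordField (p := p) b
    have hdb := (contDiffAt_chartRep (smoothFieldAt_coordField p b)).differentiableAt (by simp)
    have hdξ := (contDiffAt_chartRep (F.smooth_ξ α p)).differentiableAt (by simp)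
    simp only [F.η_eq]
    rw [dirDeriv_inner F.g _ (smoothFieldAt_coordField p b) (F.smooth_ξ α p),
      fderiv_metricInChart_apply_apply F.g hdb hdξ, hb.fderiv_eq, hb.eq_of_nhds,
      ← chartRep_self, ha.eq_of_nhds]
    simp only [fderiv_fun_const, Pi.zero_apply, _root_.zero_apply, map_zero, add_zero]
  have h := hF.closed_η α p (coordField p u) (coordField p v)
    (smoothFieldAt_coordField p u) (smoothFieldAt_coordField p v)
  rw [extDerivOne, mlieBracket_coordField_coordField, map_zero, key, key] at h
  linarith

/-- `ξ_α` is parallel: in coordinates, and after lowering an index,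
`∂_u G (v, ξ) + G (v, ∂_u ξ) = Γ₁(u, v)(ξ)`, that is, `u (G (v, ξ)) = G (∇_u v, ξ)` for constant
fields `u` and `v`. It is half the sum of the closedness equation and the Killing equation. -/
lemma IsCStructure.parallel_chart (hF : F.IsCStructure) (α : Fin s) (p : M) (u v : E) :
    fderiv ℝ (metricInChart F.g p) (extChartAt 𝓘(ℝ, E) p p) u v
        (chartRep p (F.ξ α) (extChartAt 𝓘(ℝ, E) p p))
      + metricInChart F.g p (extChartAt 𝓘(ℝ, E) p p) v
        (fderiv ℝ (chartRep p (F.ξ α)) (extChartAt 𝓘(ℝ, E) p p) u) =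
    christoffelFirst F.g p (extChartAt 𝓘(ℝ, E) p p) u v
      (chartRep p (F.ξ α) (extChartAt 𝓘(ℝ, E) p p)) := by
  have h1 := hF.killing_chart α p u v
  have h2 := hF.closed_chart α p u v
  rw [metricInChart_symm F.g _ v] at h1
  rw [christoffelFirst_apply, h1]
  linarith

/-! ### Derivatives along a curve -/

variable {γ : ℝ → M} {S : Set ℝ} {V : Π t : ℝ, TangentSpace 𝓘(ℝ, E) (γ t)} {t : ℝ}

omit [FiniteDimensional ℝ E] in
lemma fieldInChart_eq {p : M} (ht : γ t ∈ (extChartAt 𝓘(ℝ, E) p).source) :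
    fieldInChart p γ V t = chartDeriv p (γ t) (V t) :=
  mfderiv_extChartAt_apply ht _

omit [FiniteDimensional ℝ E] in
lemma chartDeriv_covDerivAlong (g : Metric E M) :
    chartDeriv (γ t) (γ t) (covDerivAlong g γ S V t) = derivWithin (fieldInChart (γ t) γ V) S t
      + christoffel g (γ t) (extChartAt 𝓘(ℝ, E) (γ t) (γ t))
        (fieldInChart (γ t) γ (velocity γ S) t) (fieldInChart (γ t) γ V t) := by
  rw [covDerivAlong, ← mfderiv_extChartAt_apply (mem_extChartAt_source _)]
  exact (isInvertible_mfderiv_extChartAt (I := 𝓘(ℝ, E))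
    (mem_extChartAt_source (γ t))).self_apply_inverse _

omit [FiniteDimensional ℝ E] in
lemma hasDerivWithinAt_extChartAt_comp (hγ : ContMDiffOn 𝓘(ℝ, ℝ) 𝓘(ℝ, E) ∞ γ S) (ht : t ∈ S) :
    HasDerivWithinAt (fun τ => extChartAt 𝓘(ℝ, E) (γ t) (γ τ))
      (fieldInChart (γ t) γ (velocity γ S) t) S t := by
  have h := ((hγ t ht).mdifferentiableWithinAt (by simp)).hasMFDerivWithinAt.2
  simp only [writtenInExtChartAt, mfld_simps] at h
  rw [fieldInChart_eq (mem_extChartAt_source _), chartDeriv_self]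
  exact HasFDerivWithinAt.hasDerivWithinAt (F := E) h

omit [FiniteDimensional ℝ E] in
lemma differentiableWithinAt_fieldInChart (hV : SmoothAlong γ S V) (ht : t ∈ S) :
    DifferentiableWithinAt ℝ (fieldInChart (γ t) γ V) S t := by
  have h := hV t ht
  rw [contMDiffWithinAt_totalSpace] at h
  have h2 := h.2.contDiffWithinAt.differentiableWithinAt (by simp)
  refine h2.congr_of_eventuallyEq_of_mem ?_ ht
  filter_upwards [h.1.continuousWithinAt.preimage_mem_nhdsWithin
    (extChartAt_source_mem_nhds (I := 𝓘(ℝ, E)) (γ t))] with τ hτ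
  rw [fieldInChart_eq hτ, chartDeriv,
    Bundle.Trivialization.continuousLinearMapAt_apply,
    Bundle.Trivialization.coe_linearMapAt_of_mem _ (mem_baseSet hτ)]

/-- As `ξ_α` is parallel, `g (V, ξ_α)' = g (∇_{γ'} V, ξ_α)` for a vector field `V` along `γ`. -/
lemma IsCStructure.hasDerivWithinAt_inner_ξ (hF : F.IsCStructure) (α : Fin s)
    (hγ : ContMDiffOn 𝓘(ℝ, ℝ) 𝓘(ℝ, E) ∞ γ S) (hV : SmoothAlong γ S V) (ht : t ∈ S) :
    HasDerivWithinAt (fun τ => F.g.inner (γ τ) (V τ) (F.ξ α (γ τ)))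
      (F.g.inner (γ t) (covDerivAlong F.g γ S V t) (F.ξ α (γ t))) S t := by
  have hc := hasDerivWithinAt_extChartAt_comp hγ ht
  have hv := (differentiableWithinAt_fieldInChart hV ht).hasDerivWithinAt
  have h := (HasDerivWithinAt.clm_apply_apply_comp
    ((contDiffAt_metricInChart F.g (γ t)).differentiableAt (by simp))
    ((contDiffAt_chartRep (F.smooth_ξ α (γ t))).differentiableAt (by simp))
    hc hv).congr_of_eventuallyEq_of_mem
    (f₁ := fun τ => F.g.inner (γ τ) (V τ) (F.ξ α (γ τ))) ?_ ht
  · refine h.congr_deriv ?_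
    have hp := hF.parallel_chart α (γ t) (fieldInChart (γ t) γ (velocity γ S) t)
      (fieldInChart (γ t) γ V t)
    rw [inner_eq_metricInChart, chartDeriv_covDerivAlong, ← chartRep_self, map_add,
      _root_.add_apply, metricInChart_christoffel, ← hp]
    ring
  · filter_upwards [(hγ t ht).continuousWithinAt.preimage_mem_nhdsWithin
      (extChartAt_source_mem_nhds (I := 𝓘(ℝ, E)) (γ t))] with τ hτ
    rw [fieldInChart_eq hτ, chartRep_apply _ hτ,
      metricInChart_chartDeriv F.g hτ]

end FramedStructure

end FramedGeometry

end

theorem proposition1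
    {E : Type*} [NormedAddCommGroup E] [NormedSpace ℝ E] [FiniteDimensional ℝ E]
    {M : Type*} [TopologicalSpace M] [ChartedSpace E M] [IsManifold 𝓘(ℝ, E) ∞ M]
    (n s : ℕ) (hdim : Module.finrank ℝ E = 2 * n + s)
    (F : FramedGeometry.FramedStructure E M s) (hF : F.IsCStructure)
    (S : Set ℝ) (hS : S.OrdConnected) (hS' : S.Nontrivial)
    (γ : ℝ → M) (hγ : FramedGeometry.IsUnitSpeed F.g γ S)
    (hLeg : FramedGeometry.IsLegendre F γ S)
    (r : ℕ) (v : ℕ → Π t : ℝ, TangentSpace 𝓘(ℝ, E) (γ t)) (κ : ℕ → ℝ → ℝ)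
    (hFr : FramedGeometry.IsFrenet F.g γ S r v κ) :
    ∀ α : Fin s, ∀ t ∈ S,
      ∀ w ∈ Submodule.span ℝ {u : TangentSpace 𝓘(ℝ, E) (γ t) | ∃ i ∈ Finset.Icc 1 r, u = v i t},
        F.g.inner (γ t) (F.ξ α (γ t)) w = 0 := by
  intro α
  have key : ∀ i, 1 ≤ i → i ≤ r → ∀ t ∈ S, F.g.inner (γ t) (v i t) (F.ξ α (γ t)) = 0 := by
    intro i
    induction i using Nat.strong_induction_on with
    | _ i ih =>
      intro hi hir t ht
      obtain rfl | ⟨j, hj, rfl⟩ : i = 1 ∨ ∃ j, 1 ≤ j ∧ i = j + 1 := by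
        rcases hi.eq_or_lt with h | h
        · exact .inl h.symm
        · exact .inr ⟨i - 1, by omega, by omega⟩
      · rw [hFr.tangent t ht]
        exact hLeg α t ht
      · have hjm : j ∈ Finset.Icc 1 r := Finset.mem_Icc.2 ⟨hj, by omega⟩
        -- the interval is nondegenerate, so derivatives within it are unique, end points included
        have hu : UniqueDiffWithinAt ℝ S t :=
          (hS.convex.nontrivial_iff_nonempty_interior.1 hS' |> uniqueDiffOn_convex hS.convex) t ht
        have h1 := hF.hasDerivWithinAt_inner_ξ α hγ.smooth (hFr.smooth j hjm) ht
        have h2 : HasDerivWithinAt (fun τ => F.g.inner (γ τ) (v j τ) (F.ξ α (γ τ))) 0 S t :=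
          (hasDerivWithinAt_const t S (0 : ℝ)).congr
            (fun τ hτ => ih j (by omega) hj (by omega) τ hτ) (ih j (by omega) hj (by omega) t ht)
        have h3 := hu.eq_deriv S h1 h2
        rw [hFr.frenet j hjm t ht, if_neg (by omega : ¬ j = r)] at h3
        -- for `j > 1` this is the induction hypothesis at `j - 1`
        have h4 : F.g.inner (γ t) (if j = 1 then 0 else -(κ (j - 1) t • v (j - 1) t))
            (F.ξ α (γ t)) = 0 := by
          split_ifs with hj1
          · simp
          · simp [ih (j - 1) (by omega) (by omega) (by omega) t ht]
        rw [map_add, _root_.add_apply, h4, zero_add, map_smul,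
          _root_.smul_apply, smul_eq_mul] at h3
        exact (mul_eq_zero.1 h3).resolve_left (hFr.curvature_pos j hj (by omega) t ht).ne'
  intro t ht w hw
  induction hw using Submodule.span_induction with
  | mem u hu =>
    obtain ⟨i, hi, rfl⟩ := hu
    rw [Finset.mem_Icc] at hi
    rw [F.g.symm, key i hi.1 hi.2 t ht]
  | zero => exact map_zero _
  | add a b _ _ ha hb => rw [map_add, ha, hb, add_zero]
  | smul c a _ ha => rw [map_smul, ha, smul_zero]
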